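/- Let $X$ be an infinite-dimensional separable Banach space over $\mathbb{R}$ or $\mathbb{C}$. Then there exists a bounded linear operator $T\colon X\to X$ that is densely mean Li-Yorke chaotic, i.e., there is a dense uncountable subset $S\subseteq X$ such that for every two distinct points $x,y\in S$, \[ \liminf_{n\to\infty}\frac1n\sum_{i=1}^n\|T^ix-T^iy\|=0 \qquad\text{and}\qquad \limsup_{n\to\infty}\frac1n\sum_{i=1}^n\|T^ix-T^iy\|>0, \] where the upper limit is allowed to be $+\infty$. -/

import Mathlib

open Filter

/-- The mean `(1/n) ∑_{i=1}^n ‖T^i x - T^i y‖`; only its behaviour for large `n` matters. -/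
noncomputable def orbitMeanDist {𝕜 X : Type*} [RCLike 𝕜] [NormedAddCommGroup X]
    [NormedSpace 𝕜 X] (T : X →L[𝕜] X) (x y : X) (n : ℕ) : ℝ :=
  (1 / (n : ℝ)) * ∑ i ∈ Finset.Icc 1 n, ‖(T ^ i) x - (T ^ i) y‖

/-- A mean Li-Yorke pair: the means have `liminf` zero and positive (possibly infinite)
`limsup`. Both are taken in the extended reals, so that unbounded means are treated correctly. -/
def IsMeanLiYorkePair {𝕜 X : Type*} [RCLike 𝕜] [NormedAddCommGroup X]
    [NormedSpace 𝕜 X] (T : X →L[𝕜] X) (x y : X) : Prop :=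
  liminf (fun n : ℕ => ((orbitMeanDist T x y n : ℝ) : EReal)) atTop = 0 ∧
    0 < limsup (fun n : ℕ => ((orbitMeanDist T x y n : ℝ) : EReal)) atTop

/-- A bounded operator is densely mean Li-Yorke chaotic if some dense uncountable set has all its
pairs of distinct points mean Li-Yorke. -/
def IsDenselyMeanLiYorkeChaotic {𝕜 X : Type*} [RCLike 𝕜] [NormedAddCommGroup X]
    [NormedSpace 𝕜 X] (T : X →L[𝕜] X) : Prop :=
  ∃ S : Set X, Dense S ∧ ¬ S.Countable ∧
    ∀ x ∈ S, ∀ y ∈ S, x ≠ y → IsMeanLiYorkePair T x y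

/-! The operator is `T = 1 + ∑ K k`, acting on the span of `e (2k)`, `e (2k+1)`, taken from a
normalized biorthogonal sequence with dense span, as a Jordan block with eigenvalue `1 - ε k < 1`
and off-diagonal entry `w k`. Each block contracts eventually, so orbits of a dense subspace tend to
zero. Before that, the block has transient growth: with `ε k = 1 / (2 N k)` and `N k * w k` large,
the mean over `N k` steps of the orbit of a unit vector is at least `k`. Hence arbitrarily small
vectors have large means at late times.

These two facts make `{y | IsMeanIrregular T (x - y)}` residual for every `x`
(`isMeanIrregular_sub_mem_residual`), and a category argument
(`exists_dense_not_countable_pairwise`) yields the dense uncountable set. -/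

/-! ### Dependent choice and Baire category -/

/-- Dependent choice along `ℕ`, where the condition on the `n`-th term refers to the earlier terms. -/
theorem exists_seq_of_forall_extend {α : Type*} [Nonempty α] (Q : ℕ → (ℕ → α) → α → Prop)
    (hcongr : ∀ n g g' y, (∀ m < n, g m = g' m) → Q n g y → Q n g' y)
    (hstep : ∀ n g, (∀ m < n, Q m g (g m)) → ∃ y, Q n g y) :
    ∃ f : ℕ → α, ∀ n, Q n f (f n) := by
  classical
  obtain ⟨a⟩ := ‹Nonempty α›
  let c : ℕ → (ℕ → α) → α := fun n g => if h : ∃ y, Q n g y then h.choose else a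
  let F : ℕ → ℕ → α := fun n => Nat.rec (fun _ => a) (fun n g => Function.update g n (c n g)) n
  have hF : ∀ n, F (n + 1) = Function.update (F n) n (c n (F n)) := fun n => rfl
  have hstable : ∀ m n, m < n → F n m = F (m + 1) m := by
    intro m n hmn
    induction n, hmn using Nat.le_induction with
    | base => rfl
    | succ n hn ih =>
      rw [hF, Function.update_of_ne (by omega), ih]
  refine ⟨fun n => F (n + 1) n, fun n => ?_⟩
  induction n using Nat.strong_induction_on with
  | _ n ih =>
    have hex : ∃ y, Q n (F n) y := by
      refine hstep n (F n) fun m hm => ?_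
      rw [hstable m n hm]
      exact hcongr m _ _ _ (fun l hl => (hstable l n (hl.trans hm)).symm) (ih m hm)
    have h1 : F (n + 1) n = hex.choose := by
      rw [hF, Function.update_self]
      exact dif_pos hex
    simp only [h1]
    exact hcongr n _ _ _ (fun m hm => hstable m n hm) hex.choose_spec

/-- If `R` is a symmetric relation on a second countable Baire space, all of whose sections are
residual, then some dense uncountable set is pairwise `R`-related. -/
theorem exists_dense_not_countable_pairwise {X : Type*} [TopologicalSpace X] [BaireSpace X]
    [SecondCountableTopology X] [Nonempty X] (R : X → X → Prop) (hsymm : ∀ x y, R x y → R y x)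
    (hirrefl : ∀ x, ¬ R x x) (hR : ∀ x, {y | R x y} ∈ residual X) :
    ∃ S : Set X, Dense S ∧ ¬ S.Countable ∧ S.Pairwise R := by
  have hdense : ∀ C : Set X, C.Countable → Dense {y | ∀ x ∈ C, R x y} := by
    intro C hC
    apply dense_of_mem_residual
    have := (countable_bInter_mem (l := residual X) hC (s := fun x _ => {y | R x y})).2
      fun x _ => hR x
    convert this using 1
    ext y
    simp
  obtain ⟨b, hbc, hb0, hb⟩ := TopologicalSpace.exists_countable_basis X
  have hbne : b.Nonempty := by
    obtain ⟨x⟩ := ‹Nonempty X›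
    obtain ⟨v, hv, -⟩ := hb.exists_subset_of_mem_open (Set.mem_univ x) isOpen_univ
    exact ⟨v, hv⟩
  obtain ⟨U, rfl⟩ := hbc.exists_eq_range hbne
  obtain ⟨f, hf⟩ := exists_seq_of_forall_extend
    (fun n (g : ℕ → X) y => y ∈ U n ∧ ∀ m < n, R (g m) y)
    (fun n g g' y h hy => ⟨hy.1, fun m hm => h m hm ▸ hy.2 m hm⟩)
    (fun n g _ => by
      have hne : (U n).Nonempty := by
        rw [Set.nonempty_iff_ne_empty]
        rintro h
        exact hb0 ⟨n, h⟩
      obtain ⟨y, hyU, hy⟩ := (hdense (g '' Set.Iio n)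
        ((Set.to_countable _).image g)).exists_mem_open (hb.isOpen ⟨n, rfl⟩) hne |>.imp
          fun y h => And.symm h
      exact ⟨y, hyU, fun m hm => hy _ ⟨m, hm, rfl⟩⟩)
  have hpair : (Set.range f).Pairwise R := by
    rintro _ ⟨m, rfl⟩ _ ⟨n, rfl⟩ hne
    rcases lt_trichotomy m n with h | h | h
    · exact (hf n).2 m h
    · exact absurd (congrArg f h) hne
    · exact hsymm _ _ ((hf m).2 n h)
  -- The range of `f` is already dense; a maximal extension cannot be countable, since residuality
  -- of the sections would supply one more point related to all of it.
  obtain ⟨S, hfS, hS⟩ := zorn_subset_nonempty {S : Set X | S.Pairwise R}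
    (fun c hc hchain _ => ⟨⋃₀ c, (Set.pairwise_sUnion hchain.directedOn).2 fun s hs => hc hs,
      fun s hs => Set.subset_sUnion_of_mem hs⟩) (Set.range f) hpair
  refine ⟨S, ?_, fun hSc => ?_, hS.prop⟩
  · refine Dense.mono hfS (hb.dense_iff.2 ?_)
    rintro _ ⟨n, rfl⟩ -
    exact ⟨f n, (hf n).1, n, rfl⟩
  · obtain ⟨y, hy⟩ := (hdense S hSc).nonempty
    have hins : (insert y S).Pairwise R :=
      Set.pairwise_insert.2 ⟨hS.prop, fun x hx _ => ⟨hsymm _ _ (hy x hx), hy x hx⟩⟩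
    exact hirrefl y (hy y (hS.le_of_ge hins (Set.subset_insert y S) (Set.mem_insert y S)))

/-! ### Biorthogonal sequences -/

/-- An infinite-dimensional separable normed space has a normalized biorthogonal sequence whose
linear span is dense. -/
theorem exists_biorthogonal_dense_span {𝕜 X : Type*} [RCLike 𝕜] [NormedAddCommGroup X]
    [NormedSpace 𝕜 X] [TopologicalSpace.SeparableSpace X] (hX : ¬ FiniteDimensional 𝕜 X) :
    ∃ (e : ℕ → X) (f : ℕ → X →L[𝕜] 𝕜), (∀ n, ‖e n‖ = 1) ∧
      (∀ m n, f m (e n) = if m = n then 1 else 0) ∧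
      Dense (Submodule.span 𝕜 (Set.range e) : Set X) := by
  classical
  obtain ⟨x, hx⟩ := TopologicalSpace.exists_dense_seq X
  obtain ⟨g, hg⟩ := exists_seq_of_forall_extend
    (fun n (g : ℕ → X × (X →L[𝕜] 𝕜)) y => ‖y.1‖ = 1 ∧ y.2 y.1 = 1 ∧
      (∀ m < n, (g m).2 y.1 = 0 ∧ y.2 (g m).1 = 0) ∧
      x n ∈ Submodule.span 𝕜 (insert y.1 ((fun m => (g m).1) '' Set.Iio n)))
    (fun n g g' y h hy => by
      refine ⟨hy.1, hy.2.1, fun m hm => h m hm ▸ hy.2.2.1 m hm, ?_⟩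
      rw [← Set.image_congr (f := fun m => (g m).1) (g := fun m => (g' m).1)
        (s := Set.Iio n) fun m hm => congrArg Prod.fst (h m hm)]
      exact hy.2.2.2)
    (fun n g hg => by
      set p : Submodule 𝕜 X := Submodule.span 𝕜 ((fun m => (g m).1) '' Set.Iio n) with hp
      have hmem : ∀ m < n, (g m).1 ∈ p := fun m hm => Submodule.subset_span ⟨m, hm, rfl⟩
      have : FiniteDimensional 𝕜 p :=
        FiniteDimensional.span_of_finite 𝕜 ((Set.finite_Iio n).image _)
      -- Absorbing `x n` into the span whenever it is not yet there makes the final span dense.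
      obtain ⟨z, hzp, hz⟩ : ∃ z, z ∉ p ∧ (x n ∈ p ∨ z = x n) := by
        by_cases hxn : x n ∈ p
        · have hne : p ≠ ⊤ := by
            intro h
            rw [h] at this
            exact hX (Module.finite_def.2 (Module.finite_def.1
              (Module.Finite.equiv (Submodule.topEquiv (R := 𝕜) (M := X)))))
          obtain ⟨z, -, hz⟩ := SetLike.exists_of_lt hne.lt_top
          exact ⟨z, hz, Or.inl hxn⟩
        · exact ⟨x n, hxn, Or.inr rfl⟩
      -- Biorthogonal projection of `z` to `p`: `z - s` is annihilated by all earlier functionals.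
      set s : X := ∑ l ∈ Finset.range n, (g l).2 z • (g l).1 with hs
      have hsp : s ∈ p := Submodule.sum_mem _ fun l hl =>
        p.smul_mem _ (hmem l (Finset.mem_range.1 hl))
      have he0p : z - s ∉ p := fun h => hzp (by simpa using p.add_mem h hsp)
      have hnorm : ‖z - s‖ ≠ 0 := fun h => he0p (by rw [norm_eq_zero.1 h]; exact p.zero_mem)
      set c : 𝕜 := ((‖z - s‖ : ℝ) : 𝕜) with hc
      have hc0 : c ≠ 0 := RCLike.ofReal_ne_zero.2 hnorm
      have hep : c⁻¹ • (z - s) ∉ p := fun h => he0p ((p.smul_mem_iff (inv_ne_zero hc0)).1 h)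
      have : IsClosed (p : Set X) := p.closed_of_finiteDimensional
      -- Choosing the functional on the quotient by `p` makes it vanish on all earlier vectors.
      obtain ⟨f, hf⟩ := SeparatingDual.exists_eq_one (R := 𝕜) (x := p.mkQ (c⁻¹ • (z - s)))
        fun h => hep ((Submodule.Quotient.mk_eq_zero p).1 h)
      have hkill : ∀ m < n, (g m).2 (z - s) = 0 := by
        intro m hm
        have : (g m).2 s = (g m).2 z := by
          rw [hs, map_sum, Finset.sum_eq_single m]
          · rw [map_smul, (hg m hm).2.1, smul_eq_mul, mul_one]
          · intro l hl hlm
            rw [map_smul, smul_eq_mul]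
            rcases lt_or_gt_of_ne hlm with h | h
            · rw [((hg m hm).2.2.1 l h).2, mul_zero]
            · rw [((hg l (Finset.mem_range.1 hl)).2.2.1 m h).1, mul_zero]
          · intro h
            exact absurd (Finset.mem_range.2 hm) h
        rw [map_sub, this, sub_self]
      refine ⟨(c⁻¹ • (z - s), f.comp p.mkQL), ?_, hf, fun m hm => ⟨?_, ?_⟩, ?_⟩
      · rw [norm_smul, norm_inv, hc, RCLike.norm_ofReal, abs_norm, inv_mul_cancel₀ hnorm]
      · rw [map_smul, hkill m hm, smul_zero]
      · have : p.mkQL (g m).1 = 0 := (Submodule.Quotient.mk_eq_zero p).2 (hmem m hm)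
        rw [ContinuousLinearMap.comp_apply, this, map_zero]
      · have hle : p ≤ Submodule.span 𝕜
            (insert (c⁻¹ • (z - s)) ((fun m => (g m).1) '' Set.Iio n)) :=
          Submodule.span_mono (Set.subset_insert _ _)
        rcases hz with h | h
        · exact hle h
        · have hdecomp : x n = c • (c⁻¹ • (z - s)) + s := by
            rw [smul_inv_smul₀ hc0, sub_add_cancel, h]
          rw [hdecomp]
          exact Submodule.add_mem _
            (Submodule.smul_mem _ _ (Submodule.subset_span (Set.mem_insert _ _))) (hle hsp))
  refine ⟨fun n => (g n).1, fun n => (g n).2, fun n => (hg n).1, fun m n => ?_, ?_⟩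
  · rcases lt_trichotomy m n with h | rfl | h
    · rw [if_neg h.ne, ((hg n).2.2.1 m h).1]
    · rw [if_pos rfl, (hg m).2.1]
    · rw [if_neg h.ne', ((hg m).2.2.1 n h).2]
  · refine hx.mono ?_
    rintro _ ⟨n, rfl⟩
    refine Submodule.span_mono ?_ (hg n).2.2.2
    rintro y (rfl | ⟨m, -, rfl⟩)
    exacts [⟨n, rfl⟩, ⟨m, rfl⟩]

/-! ### Orbit means and mean irregular vectors -/

/-- The mean of the norms of the first `n` iterates of `z`. -/
noncomputable def orbitMeanNorm {𝕜 X : Type*} [RCLike 𝕜] [NormedAddCommGroup X]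
    [NormedSpace 𝕜 X] (T : X →L[𝕜] X) (n : ℕ) (z : X) : ℝ :=
  (1 / (n : ℝ)) * ∑ i ∈ Finset.Icc 1 n, ‖(T ^ i) z‖

section OrbitMean

variable {𝕜 X : Type*} [RCLike 𝕜] [NormedAddCommGroup X] [NormedSpace 𝕜 X] (T : X →L[𝕜] X)

theorem orbitMeanDist_eq (x y : X) (n : ℕ) :
    orbitMeanDist T x y n = orbitMeanNorm T n (x - y) := by
  simp only [orbitMeanDist, orbitMeanNorm, map_sub]

theorem continuous_orbitMeanNorm (n : ℕ) : Continuous (orbitMeanNorm T n) := by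
  unfold orbitMeanNorm
  fun_prop

theorem orbitMeanNorm_nonneg (n : ℕ) (z : X) : 0 ≤ orbitMeanNorm T n z := by
  unfold orbitMeanNorm
  positivity

theorem orbitMeanNorm_sub_comm (n : ℕ) (x y : X) :
    orbitMeanNorm T n (x - y) = orbitMeanNorm T n (y - x) := by
  unfold orbitMeanNorm
  simp only [map_sub, norm_sub_rev]

theorem orbitMeanNorm_smul (n : ℕ) (c : 𝕜) (z : X) :
    orbitMeanNorm T n (c • z) = ‖c‖ * orbitMeanNorm T n z := by
  simp only [orbitMeanNorm, map_smul, norm_smul, ← Finset.mul_sum]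
  ring

theorem orbitMeanNorm_le_add (n : ℕ) (x y : X) :
    orbitMeanNorm T n y ≤ orbitMeanNorm T n (x + y) + orbitMeanNorm T n x := by
  simp only [orbitMeanNorm, ← mul_add, ← Finset.sum_add_distrib]
  gcongr with i
  rw [map_add]
  calc ‖(T ^ i) y‖ = ‖((T ^ i) x + (T ^ i) y) - (T ^ i) x‖ := by rw [add_sub_cancel_left]
    _ ≤ _ := norm_sub_le _ _

theorem tendsto_orbitMeanNorm {z : X} (hz : Tendsto (fun n : ℕ => (T ^ n) z) atTop (nhds 0)) :
    Tendsto (fun n => orbitMeanNorm T n z) atTop (nhds 0) := by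
  have h := ((tendsto_zero_iff_norm_tendsto_zero.1 hz).comp (tendsto_add_atTop_nat 1)).cesaro
  refine h.congr fun n => ?_
  rw [orbitMeanNorm, one_div, Finset.range_eq_Ico]
  exact congrArg _ (Finset.sum_Ico_add' (fun i => ‖(T ^ i) z‖) 0 n 1)

/-- A vector whose orbit means come infinitely often close to `0` and infinitely often exceed `1`. -/
def IsMeanIrregular (z : X) : Prop :=
  (∀ k : ℕ, ∃ᶠ n in atTop, orbitMeanNorm T n z < 1 / (k + 1)) ∧
    ∃ᶠ n in atTop, 1 < orbitMeanNorm T n z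

variable {T}

theorem not_isMeanIrregular_zero : ¬ IsMeanIrregular T 0 := by
  intro h
  obtain ⟨n, hn⟩ := h.2.exists
  simp only [orbitMeanNorm, map_zero, norm_zero, Finset.sum_const_zero, mul_zero] at hn
  linarith

theorem IsMeanIrregular.isMeanLiYorkePair {x y : X} (h : IsMeanIrregular T (x - y)) :
    IsMeanLiYorkePair T x y := by
  simp only [IsMeanLiYorkePair, orbitMeanDist_eq]
  constructor
  · apply le_antisymm
    · refine le_of_forall_gt fun a ha => ?_
      obtain ⟨r, hr0, hra⟩ := EReal.lt_iff_exists_real_btwn.1 ha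
      obtain ⟨k, hk⟩ := exists_nat_one_div_lt (EReal.coe_pos.1 hr0)
      refine lt_of_le_of_lt (liminf_le_of_frequently_le ((h.1 k).mono fun n hn => ?_)) hra
      exact EReal.coe_le_coe_iff.2 (hn.trans hk).le
    · exact le_liminf_of_le (h := Eventually.of_forall fun n =>
        EReal.coe_nonneg.2 (orbitMeanNorm_nonneg T n _))
  · refine lt_of_lt_of_le (b := ((1 : ℝ) : EReal)) (by exact_mod_cast one_pos) ?_
    exact le_limsup_of_frequently_le (h.2.mono fun n hn => EReal.coe_le_coe_iff.2 hn.le)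

theorem isOpen_exists_orbitMeanNorm_mem (O : Set ℝ) (hO : IsOpen O) (N : ℕ) :
    IsOpen {z | ∃ n ≥ N, orbitMeanNorm T n z ∈ O} := by
  have : {z | ∃ n ≥ N, orbitMeanNorm T n z ∈ O} =
      ⋃ n ≥ N, orbitMeanNorm T n ⁻¹' O := by ext; simp
  rw [this]
  exact isOpen_biUnion fun n _ => hO.preimage (continuous_orbitMeanNorm T n)

/-- If the orbits of a dense set of vectors tend to zero and there are arbitrarily small vectors
with a large orbit mean, then the translates of the set of mean irregular vectors are residual. -/
theorem isMeanIrregular_sub_mem_residual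
    (hdense : Dense {z : X | Tendsto (fun n : ℕ => (T ^ n) z) atTop (nhds 0)})
    (hlarge : ∀ δ > 0, ∀ N : ℕ, ∃ y : X, ‖y‖ < δ ∧ ∃ n ≥ N, 2 < orbitMeanNorm T n y) (x : X) :
    {y | IsMeanIrregular T (x - y)} ∈ residual X := by
  have key : ∀ U : Set X, IsOpen U → Dense U → {y | x - y ∈ U} ∈ residual X := fun U hU hUd =>
    residual_of_dense_open (hU.preimage (Homeomorph.subLeft x).continuous)
      (hUd.preimage (Homeomorph.subLeft x).isOpenMap)
  have hsmall : ∀ k N : ℕ,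
      {y | x - y ∈ {z | ∃ n ≥ N, orbitMeanNorm T n z ∈ Set.Iio (1 / ((k : ℝ) + 1))}} ∈
        residual X := fun k N => by
    refine key _ (isOpen_exists_orbitMeanNorm_mem _ isOpen_Iio N) (hdense.mono fun z hz => ?_)
    obtain ⟨n, hn, hnN⟩ := (((tendsto_orbitMeanNorm T hz).eventually_lt_const
      (Nat.one_div_pos_of_nat (n := k))).and (eventually_ge_atTop N)).exists
    exact ⟨n, hnN, hn⟩
  have hbig : ∀ N : ℕ,
      {y | x - y ∈ {z | ∃ n ≥ N, orbitMeanNorm T n z ∈ Set.Ioi (1 : ℝ)}} ∈ residual X := fun N => by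
    refine key _ (isOpen_exists_orbitMeanNorm_mem _ isOpen_Ioi N) ?_
    refine Metric.dense_iff.2 fun w r hr => ?_
    -- Perturb a nearby `z` with null orbit by a small `y`: at a late time the mean of `y` exceeds 2
    -- and that of `z` is below 1, so that of `z + y` exceeds 1.
    obtain ⟨z, hzw, hz⟩ := Metric.dense_iff.1 hdense w (r / 2) (half_pos hr)
    obtain ⟨M, hM⟩ := eventually_atTop.1
      ((tendsto_orbitMeanNorm T hz).eventually_lt_const one_pos)
    obtain ⟨y, hy, n, hn, hny⟩ := hlarge (r / 2) (half_pos hr) (max M N)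
    refine ⟨z + y, ?_, n, le_of_max_le_right hn, ?_⟩
    · rw [Metric.mem_ball, dist_eq_norm] at hzw ⊢
      calc ‖z + y - w‖ = ‖(z - w) + y‖ := by congr 1; abel
        _ ≤ ‖z - w‖ + ‖y‖ := norm_add_le _ _
        _ < r := by linarith
    · have h1 := orbitMeanNorm_le_add T n z y
      have h2 := hM n (le_of_max_le_left hn)
      rw [Set.mem_Ioi]
      linarith
  filter_upwards [countable_iInter_mem.2 fun k => countable_iInter_mem.2 (hsmall k),
    countable_iInter_mem.2 hbig] with y h1 h2
  simp only [Set.mem_iInter] at h1 h2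
  exact ⟨fun k => frequently_atTop.2 (h1 k), frequently_atTop.2 h2⟩

/-- Completeness provides the Baire property and separability the countable base that the category
argument needs. -/
theorem isDenselyMeanLiYorkeChaotic_of_dense_of_large [CompleteSpace X]
    [TopologicalSpace.SeparableSpace X]
    (hdense : Dense {z : X | Tendsto (fun n : ℕ => (T ^ n) z) atTop (nhds 0)})
    (hlarge : ∀ δ > 0, ∀ N : ℕ, ∃ y : X, ‖y‖ < δ ∧ ∃ n ≥ N, 2 < orbitMeanNorm T n y) :
    IsDenselyMeanLiYorkeChaotic T := by
  have := UniformSpace.secondCountable_of_separable X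
  obtain ⟨S, hS, hSc, hSp⟩ := exists_dense_not_countable_pairwise
    (fun x y : X => IsMeanIrregular T (x - y))
    (fun x y h => by simpa only [IsMeanIrregular, orbitMeanNorm_sub_comm T _ x y] using h)
    (fun x h => not_isMeanIrregular_zero (T := T) (by simpa using h))
    (isMeanIrregular_sub_mem_residual hdense hlarge)
  exact ⟨S, hS, hSc, fun x hx y hy hxy => (hSp hx hy hxy).isMeanLiYorkePair⟩

/-! ### Dynamics of a Jordan block -/

/-- The powers of a Jordan block of size two. -/
theorem pow_succ_apply_of_jordanBlock {a b : X} {r w : 𝕜} (ha : T a = r • a)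
    (hb : T b = r • b + w • a) (n : ℕ) :
    (T ^ (n + 1)) b = r ^ (n + 1) • b + ((n + 1) * r ^ n * w) • a := by
  induction n with
  | zero => simp [hb]
  | succ n ih =>
    rw [pow_succ', mul_apply_eq_comp, ih, map_add, map_smul, map_smul, ha, hb]
    push_cast
    module

theorem tendsto_pow_apply_of_eigenvector {a : X} {ρ : ℝ} (h0 : 0 ≤ ρ) (h1 : ρ < 1)
    (ha : T a = (ρ : 𝕜) • a) : Tendsto (fun n : ℕ => (T ^ n) a) atTop (nhds 0) := by
  have hpow : ∀ n : ℕ, (T ^ n) a = (ρ : 𝕜) ^ n • a := fun n => by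
    induction n with
    | zero => simp
    | succ n ih =>
      rw [pow_succ', mul_apply_eq_comp, ih, map_smul, ha, smul_smul, pow_succ]
  have hρ : Tendsto (fun n : ℕ => (ρ : 𝕜) ^ n) atTop (nhds 0) :=
    tendsto_pow_atTop_nhds_zero_of_norm_lt_one
      (by rwa [RCLike.norm_ofReal, abs_of_nonneg h0])
  simpa only [hpow, zero_smul] using hρ.smul_const a

/-- The off-diagonal entry contributes only a factor linear in `n`, which geometric decay beats. -/
theorem tendsto_pow_apply_of_jordanBlock {a b : X} {ρ : ℝ} {w : 𝕜} (h0 : 0 ≤ ρ) (h1 : ρ < 1)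
    (ha : T a = (ρ : 𝕜) • a) (hb : T b = (ρ : 𝕜) • b + w • a) :
    Tendsto (fun n : ℕ => (T ^ n) b) atTop (nhds 0) := by
  rw [← tendsto_add_atTop_iff_nat 1]
  simp only [pow_succ_apply_of_jordanBlock ha hb]
  have hρ : Tendsto (fun n : ℕ => ρ ^ n) atTop (nhds 0) :=
    tendsto_pow_atTop_nhds_zero_of_lt_one h0 h1
  have hρ1 : Tendsto (fun n : ℕ => (((ρ ^ (n + 1) : ℝ)) : 𝕜)) atTop (nhds ((0 : ℝ) : 𝕜)) :=
    (RCLike.continuous_ofReal.tendsto 0).comp (hρ.comp (tendsto_add_atTop_nat 1))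
  have hρ2 : Tendsto (fun n : ℕ => (((n * ρ ^ n + ρ ^ n : ℝ)) : 𝕜)) atTop
      (nhds (((0 + 0 : ℝ)) : 𝕜)) :=
    (RCLike.continuous_ofReal.tendsto _).comp
      ((tendsto_self_mul_const_pow_of_lt_one h0 h1).add hρ)
  have := (hρ1.smul_const b).add ((hρ2.mul_const w).smul_const a)
  simp only [add_zero, RCLike.ofReal_zero, zero_smul, zero_mul] at this
  refine this.congr fun n => ?_
  push_cast
  congr 3
  ring

/-- A normalized Jordan block with eigenvalue `1 - 1 / (2 n)` and off-diagonal entry `w` has an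
orbit mean of order `n * w`. -/
theorem le_orbitMeanNorm_of_jordanBlock {a b : X} {n : ℕ} (hn : 1 ≤ n) {w : ℝ} (hw : 0 ≤ w)
    (hna : ‖a‖ = 1) (hnb : ‖b‖ = 1) (ha : T a = ((1 - 1 / (2 * n) : ℝ) : 𝕜) • a)
    (hb : T b = ((1 - 1 / (2 * n) : ℝ) : 𝕜) • b + (w : 𝕜) • a) :
    n * w / 4 - 1 ≤ orbitMeanNorm T n b := by
  have hn0 : (1 : ℝ) ≤ n := by exact_mod_cast hn
  set ρ : ℝ := 1 - 1 / (2 * n) with hρ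
  have hε : 1 / (2 * (n : ℝ)) ≤ 1 := by
    rw [div_le_one (by positivity)]
    linarith
  have hρ0 : 0 ≤ ρ := by linarith
  have hρ1 : ρ ≤ 1 := by
    have : 0 ≤ 1 / (2 * (n : ℝ)) := by positivity
    linarith
  have hterm : ∀ j < n, ((j : ℝ) + 1) * w / 2 - 1 ≤ ‖(T ^ (j + 1)) b‖ := by
    intro j hj
    -- Bernoulli: `ρ ^ j ≥ 1 - j / (2 n) ≥ 1 / 2`, so up to time `n` the decay costs at most a
    -- factor 2.
    have hbern : 1 / 2 ≤ ρ ^ j := by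
      have h := one_add_mul_le_pow (a := -(1 / (2 * (n : ℝ)))) (by linarith) j
      rw [← sub_eq_add_neg, ← hρ] at h
      refine le_trans ?_ h
      have : (j : ℝ) * (1 / (2 * n)) ≤ n * (1 / (2 * n)) := by gcongr
      have h2 : (n : ℝ) * (1 / (2 * n)) = 1 / 2 := by field_simp
      linarith
    have h1 : ‖(ρ : 𝕜) ^ (j + 1) • b‖ ≤ 1 := by
      rw [norm_smul, hnb, norm_pow, RCLike.norm_ofReal, abs_of_nonneg hρ0, mul_one]
      exact pow_le_one₀ hρ0 hρ1
    have h2 : ‖(((j : 𝕜) + 1) * (ρ : 𝕜) ^ j * (w : 𝕜)) • a‖ = (j + 1) * ρ ^ j * w := by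
      have : ((j : 𝕜) + 1) * (ρ : 𝕜) ^ j * (w : 𝕜) = (((j + 1) * ρ ^ j * w : ℝ) : 𝕜) := by
        push_cast
        ring
      rw [this, norm_smul, hna, RCLike.norm_ofReal, abs_of_nonneg (by positivity), mul_one]
    have h3 : ((j : ℝ) + 1) * (1 / 2) * w ≤ (j + 1) * ρ ^ j * w := by gcongr
    rw [pow_succ_apply_of_jordanBlock ha hb]
    have h4 := norm_sub_le ((ρ : 𝕜) ^ (j + 1) • b + (((j : 𝕜) + 1) * (ρ : 𝕜) ^ j * (w : 𝕜)) • a)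
      ((ρ : 𝕜) ^ (j + 1) • b)
    rw [add_sub_cancel_left, h2] at h4
    linarith
  have hsum : ∀ m : ℕ, ∑ j ∈ Finset.range m, (((j : ℝ) + 1) * w / 2 - 1) =
      m * ((m + 1) * w / 4 - 1) := by
    intro m
    induction m with
    | zero => simp
    | succ m ih =>
      rw [Finset.sum_range_succ, ih]
      push_cast
      ring
  have hle : n * ((n + 1) * w / 4 - 1) ≤ ∑ i ∈ Finset.Icc 1 n, ‖(T ^ i) b‖ := by
    rw [← hsum n]
    refine (Finset.sum_le_sum fun j hj => hterm j (Finset.mem_range.1 hj)).trans_eq ?_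
    rw [Finset.range_eq_Ico]
    exact Finset.sum_Ico_add' (fun i => ‖(T ^ i) b‖) 0 n 1
  rw [orbitMeanNorm, one_div, le_inv_mul_iff₀ (by linarith)]
  refine le_trans ?_ hle
  gcongr
  linarith

end OrbitMean

/-! ### Construction of the operator -/

/-- Along a normalized biorthogonal sequence, any Jordan blocks `!![1 - ε k, w k; 0, 1 - ε k]` with
sufficiently small entries are realized by a bounded operator. -/
theorem exists_operator_jordanBlocks {𝕜 X : Type*} [RCLike 𝕜] [NormedAddCommGroup X]
    [NormedSpace 𝕜 X] [CompleteSpace X] {e : ℕ → X} {f : ℕ → X →L[𝕜] 𝕜} (he : ∀ n, ‖e n‖ = 1)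
    (hf : ∀ m n, f m (e n) = if m = n then 1 else 0) {ε w : ℕ → ℝ} (hε : ∀ k, 0 ≤ ε k)
    (hεw : ∀ k, ε k ≤ w k)
    (hw : ∀ k, w k = (1 / 2) ^ k / (‖f (2 * k)‖ + ‖f (2 * k + 1)‖ + 1)) :
    ∃ T : X →L[𝕜] X, (∀ k, T (e (2 * k)) = ((1 - ε k : ℝ) : 𝕜) • e (2 * k)) ∧
      ∀ k, T (e (2 * k + 1)) =
        ((1 - ε k : ℝ) : 𝕜) • e (2 * k + 1) + (w k : 𝕜) • e (2 * k) := by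
  set K : ℕ → X →L[𝕜] X := fun k =>
    (f (2 * k)).smulRight (-(ε k : 𝕜) • e (2 * k)) +
      (f (2 * k + 1)).smulRight (-(ε k : 𝕜) • e (2 * k + 1) + (w k : 𝕜) • e (2 * k)) with hK
  -- Dividing by the norms of the functionals in `w k` offsets their possible growth, so `∑ K k`
  -- converges in norm.
  have hbound : ∀ k, ‖K k‖ ≤ 2 * (1 / 2) ^ k := by
    intro k
    have hw0 : 0 ≤ w k := (hε k).trans (hεw k)
    have h1 : ‖-(ε k : 𝕜) • e (2 * k)‖ ≤ w k := by
      rw [norm_smul, he, norm_neg, RCLike.norm_ofReal, abs_of_nonneg (hε k), mul_one]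
      exact hεw k
    have h2 : ‖-(ε k : 𝕜) • e (2 * k + 1) + (w k : 𝕜) • e (2 * k)‖ ≤ w k + w k := by
      refine (norm_add_le _ _).trans (add_le_add ?_ ?_)
      · rw [norm_smul, he, norm_neg, RCLike.norm_ofReal, abs_of_nonneg (hε k), mul_one]
        exact hεw k
      · rw [norm_smul, he, RCLike.norm_ofReal, abs_of_nonneg hw0, mul_one]
    calc ‖K k‖ ≤ ‖f (2 * k)‖ * w k + ‖f (2 * k + 1)‖ * (w k + w k) := by
          refine (norm_add_le _ _).trans ?_
          rw [ContinuousLinearMap.norm_smulRight_apply, ContinuousLinearMap.norm_smulRight_apply]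
          gcongr
      _ ≤ 2 * (w k * (‖f (2 * k)‖ + ‖f (2 * k + 1)‖ + 1)) := by
          have := mul_nonneg hw0 (norm_nonneg (f (2 * k)))
          linarith
      _ = 2 * (1 / 2) ^ k := by
          rw [hw k, div_mul_cancel₀ _ (by positivity)]
  have hsum : Summable K := Summable.of_norm_bounded
    ((summable_geometric_of_lt_one (by norm_num) (by norm_num)).mul_left 2) hbound
  have happ : ∀ k v, (∀ j, j ≠ k → K j v = 0) → (1 + ∑' j, K j) v = v + K k v := by
    intro k v h
    have h1 : HasSum (fun j => K j v) ((∑' j, K j) v) :=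
      hsum.hasSum.map (ContinuousLinearMap.apply 𝕜 X v) (ContinuousLinearMap.continuous _)
    rw [add_apply, one_apply_eq_self,
      h1.unique (hasSum_single k h)]
  refine ⟨1 + ∑' k, K k, fun k => ?_, fun k => ?_⟩
  · rw [happ k]
    · have h1 : 2 * k + 1 ≠ 2 * k := by omega
      simp only [hK, add_apply, ContinuousLinearMap.smulRight_apply, hf, h1,
        if_true, if_false]
      push_cast
      module
    · intro j hj
      have h1 : 2 * j ≠ 2 * k := by omega
      have h2 : 2 * j + 1 ≠ 2 * k := by omega
      simp only [hK, add_apply, ContinuousLinearMap.smulRight_apply, hf, h1, h2,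
        if_false, zero_smul, add_zero]
  · rw [happ k]
    · have h1 : 2 * k ≠ 2 * k + 1 := by omega
      simp only [hK, add_apply, ContinuousLinearMap.smulRight_apply, hf, h1,
        if_true, if_false]
      push_cast
      module
    · intro j hj
      have h1 : 2 * j ≠ 2 * k + 1 := by omega
      have h2 : 2 * j + 1 ≠ 2 * k + 1 := by omega
      simp only [hK, add_apply, ContinuousLinearMap.smulRight_apply, hf, h1, h2,
        if_false, zero_smul, add_zero]

theorem corollary1p3 {𝕜 : Type*} [RCLike 𝕜] {X : Type*} [NormedAddCommGroup X]
    [NormedSpace 𝕜 X] [CompleteSpace X] [TopologicalSpace.SeparableSpace X]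
    (hX : ¬ FiniteDimensional 𝕜 X) :
    ∃ T : X →L[𝕜] X, IsDenselyMeanLiYorkeChaotic T := by
  obtain ⟨e, f, he, hf, hspan⟩ := exists_biorthogonal_dense_span hX
  set w : ℕ → ℝ := fun k => (1 / 2) ^ k / (‖f (2 * k)‖ + ‖f (2 * k + 1)‖ + 1) with hw
  have hw0 : ∀ k, 0 < w k := fun k => by positivity
  -- The bound `4 * (k + 1)` turns the mean estimate `N * w / 4 - 1` into `k`, and also gives `1 /
  -- (2 N) ≤ w k`; `k ≤ N` makes the times arbitrarily late.
  have hN : ∀ k, ∃ N : ℕ, 1 ≤ N ∧ k ≤ N ∧ 4 * (k + 1) ≤ N * w k := by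
    intro k
    obtain ⟨M, hM⟩ := exists_nat_ge (4 * ((k : ℝ) + 1) / w k)
    refine ⟨max M (k + 1), by omega, by omega, ?_⟩
    rw [div_le_iff₀ (hw0 k)] at hM
    refine hM.trans (mul_le_mul_of_nonneg_right ?_ (hw0 k).le)
    exact_mod_cast le_max_left _ _
  choose N hN1 hkN hNw using hN
  have hN0 : ∀ k, (1 : ℝ) ≤ N k := fun k => by exact_mod_cast hN1 k
  have hε : ∀ k, 0 < 1 / (2 * (N k : ℝ)) := fun k => by
    have := hN0 k
    positivity
  have hε1 : ∀ k, 1 / (2 * (N k : ℝ)) ≤ 1 := fun k => by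
    have := hN0 k
    rw [div_le_one (by positivity)]
    linarith
  obtain ⟨T, hT0, hT1⟩ := exists_operator_jordanBlocks he hf (fun k => (hε k).le)
    (fun k => by
      have h1 := hN0 k
      have h2 := hNw k
      have h3 : (0 : ℝ) ≤ k := Nat.cast_nonneg k
      rw [div_le_iff₀ (by positivity)]
      linarith) (fun k => congrFun hw k)
  refine ⟨T, isDenselyMeanLiYorkeChaotic_of_dense_of_large (hspan.mono fun z hz => ?_) ?_⟩
  · rw [SetLike.mem_coe] at hz
    rw [Set.mem_ofPred_eq]
    induction hz using Submodule.span_induction with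
    | mem x hx =>
      obtain ⟨n, rfl⟩ := hx
      obtain ⟨k, rfl | rfl⟩ := Nat.even_or_odd' n
      · exact tendsto_pow_apply_of_eigenvector (sub_nonneg.2 (hε1 k)) (sub_lt_self _ (hε k)) (hT0 k)
      · exact tendsto_pow_apply_of_jordanBlock (sub_nonneg.2 (hε1 k)) (sub_lt_self _ (hε k))
          (hT0 k) (hT1 k)
    | zero => simp
    | add x y _ _ hx hy => simpa only [map_add, add_zero] using hx.add hy
    | smul c x _ hx => simpa only [map_smul, smul_zero] using hx.const_smul c
  · intro δ hδ M
    obtain ⟨k₀, hk₀⟩ := exists_nat_gt (4 / δ)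
    set k := max k₀ M
    have hk : 4 / δ < k := hk₀.trans_le (by exact_mod_cast le_max_left _ _)
    rw [div_lt_iff₀ hδ] at hk
    -- The scaled mean is at least `k * δ / 2`, which exceeds 2 because `k > 4 / δ`.
    refine ⟨((δ / 2 : ℝ) : 𝕜) • e (2 * k + 1), ?_, N k, (le_max_right _ _).trans (hkN k), ?_⟩
    · rw [norm_smul, he, RCLike.norm_ofReal, abs_of_pos (half_pos hδ), mul_one]
      exact half_lt_self hδ
    · have hmean := le_orbitMeanNorm_of_jordanBlock (hN1 k) (hw0 k).le (he _) (he _) (hT0 k) (hT1 k)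
      have hkmean : (k : ℝ) ≤ orbitMeanNorm T (N k) (e (2 * k + 1)) := by
        have := hNw k
        linarith
      rw [orbitMeanNorm_smul, RCLike.norm_ofReal, abs_of_pos (half_pos hδ)]
      have := mul_le_mul_of_nonneg_left hkmean (half_pos hδ).le
      linarith
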